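/- Let $r,\mu,\sigma,c,\lambda,b$ be real numbers with $r>0$, $\mu>r$, $\sigma>0$, $c>0$, $\lambda>0$ and $b<w_s:=c/r$. Put $$R=\frac12\Big(\frac{\mu-r}{\sigma}\Big)^2,\qquad d=\frac1{2r}\Big[(r+\lambda+R)+\sqrt{(r+\lambda+R)^2-4r\lambda}\Big],\qquad \pi_0(w)=\frac{\mu-r}{\sigma^2}\,\frac{c-rw}{(d-1)r}.$$ For $\varepsilon\ge 0$ consider the Dirichlet problem for the Hamilton–Jacobi–Bellman equation of the robust lifetime ruin problem, $$F_\varepsilon(w,u,u',u''):=\lambda u-\inf_{\pi\in\mathbb R}\Big\{\tfrac12\sigma^2\big(\varepsilon (u')^2+u''\big)\pi^2+(\mu-r)u'\pi+(rw-c)u'\Big\}=0\ \text{ in }(b,w_s),\qquad u(b)=1,\ u(w_s)=0,$$ where $F_\varepsilon$ takes values in $(-\infty,+\infty]$. Then for every $\varepsilon\ge0$ this problem has exactly one non-negative viscosity solution $\hat u(\cdot\,;\varepsilon)$ that is continuous on $[b,w_s]$. It belongs to $C^2[b,w_s)$ and satisfies $\varepsilon(\hat u')^2+\hat u''>0$ on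 $[b,w_s)$ (derivatives at $b$ are one-sided), so that the optimal investment feedback $$\pi^*(w;\varepsilon)=-\frac{\mu-r}{\sigma^2}\,\frac{\hat u'(w;\varepsilon)}{\varepsilon\,\hat u'(w;\varepsilon)^2+\hat u''(w;\varepsilon)},\qquad w\in[b,w_s),$$ is well defined; it attains the infimum in $F_\varepsilon(w,\hat u,\hat u',\hat u'')$. For every $w\in[b,w_s)$, the function $\varepsilon\mapsto\pi^*(w;\varepsilon)$ is non-increasing on $[0,\infty)$. Moreover $\pi^*(w;0)=\pi_0(w)$; in particular, $\pi^*(w;\varepsilon)\le\pi_0(w)$ for all $\varepsilon\ge0$ and $w\in[b,w_s)$. -/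

import Mathlib

open Set

noncomputable section

namespace RobustRuin

/-- Parameters of the model: interest rate `r`, drift `mu` and volatility `sigma` of the risky
asset, consumption rate `c`, hazard rate `lam`, ruin level `b`. -/
structure Params where
  r : ℝ
  mu : ℝ
  sigma : ℝ
  c : ℝ
  lam : ℝ
  b : ℝ

/-- The standing assumptions on the parameters. The last one says that the ruin level lies below
the safe level `c / r`. -/
structure Params.Admissible (P : Params) : Prop where
  r_pos : 0 < P.r
  r_lt_mu : P.r < P.mu
  sigma_pos : 0 < P.sigma
  c_pos : 0 < P.c
  lam_pos : 0 < P.lam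
  b_lt : P.b < P.c / P.r

/-- The safe level `w_s = c / r`. -/
def Params.ws (P : Params) : ℝ := P.c / P.r

/-- `R = ((mu - r) / sigma)² / 2`. -/
def Params.R (P : Params) : ℝ := 1 / 2 * ((P.mu - P.r) / P.sigma) ^ 2

/-- `d = ((r + lam + R) + √((r + lam + R)² - 4 r lam)) / (2 r)`. -/
def Params.d (P : Params) : ℝ :=
  1 / (2 * P.r) *
    ((P.r + P.lam + P.R) + Real.sqrt ((P.r + P.lam + P.R) ^ 2 - 4 * P.r * P.lam))

/-- The expression inside the infimum of the Hamilton-Jacobi-Bellman equation, at wealth `w`, with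
first derivative `p`, second derivative `A` and investment `π`. -/
def ham (P : Params) (ε w p A π : ℝ) : ℝ :=
  1 / 2 * P.sigma ^ 2 * (ε * p ^ 2 + A) * π ^ 2 + (P.mu - P.r) * p * π + (P.r * w - P.c) * p

/-- The operator `F(w, u, u', u'') = lam u - inf_π ham`, with values in `(-∞, +∞]`. The infimum is
taken in the extended reals: it is `-∞`, and `F` is `+∞`, where `ham` is unbounded below. -/
def F (P : Params) (ε w u p A : ℝ) : EReal :=
  ((P.lam * u : ℝ) : EReal) - ⨅ π : ℝ, ((ham P ε w p A π : ℝ) : EReal)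

/-- `u` satisfies the viscosity subsolution inequality for `F = 0` in `(b, w_s)`. -/
def IsViscositySubsolution (P : Params) (ε : ℝ) (u : ℝ → ℝ) : Prop :=
  ∀ φ : ℝ → ℝ, ContDiffOn ℝ 2 φ (Ioo P.b P.ws) → ∀ w ∈ Ioo P.b P.ws,
    IsLocalMax (fun x => u x - φ x) w → F P ε w (u w) (deriv φ w) (deriv (deriv φ) w) ≤ 0

/-- `u` satisfies the viscosity supersolution inequality for `F = 0` in `(b, w_s)`. -/
def IsViscositySupersolution (P : Params) (ε : ℝ) (u : ℝ → ℝ) : Prop :=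
  ∀ φ : ℝ → ℝ, ContDiffOn ℝ 2 φ (Ioo P.b P.ws) → ∀ w ∈ Ioo P.b P.ws,
    IsLocalMin (fun x => u x - φ x) w → 0 ≤ F P ε w (u w) (deriv φ w) (deriv (deriv φ) w)

/-- `u` is a non-negative continuous viscosity solution on `[b, w_s]` of the Dirichlet problem
`F(w, u, u', u'') = 0` in `(b, w_s)`, `u(b) = 1`, `u(w_s) = 0`. Boundedness is automatic, by
continuity on a compact interval. -/
structure IsDirichletSolution (P : Params) (ε : ℝ) (u : ℝ → ℝ) : Prop where
  continuousOn : ContinuousOn u (Icc P.b P.ws)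
  nonneg : ∀ w ∈ Icc P.b P.ws, 0 ≤ u w
  sub : IsViscositySubsolution P ε u
  super : IsViscositySupersolution P ε u
  left : u P.b = 1
  right : u P.ws = 0

/-- The first derivative of `u` on `[b, w_s)` (one-sided at `b`). -/
def D1 (P : Params) (u : ℝ → ℝ) (w : ℝ) : ℝ := derivWithin u (Ico P.b P.ws) w

/-- The second derivative of `u` on `[b, w_s)` (one-sided at `b`). -/
def D2 (P : Params) (u : ℝ → ℝ) (w : ℝ) : ℝ := derivWithin (D1 P u) (Ico P.b P.ws) w

/-- The feedback form `π* = -((mu - r) / sigma²) u' / (ε (u')² + u'')`, on `[b, w_s)`. -/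
def piStar (P : Params) (ε : ℝ) (u : ℝ → ℝ) (w : ℝ) : ℝ :=
  -((P.mu - P.r) / P.sigma ^ 2) * (D1 P u w / (ε * (D1 P u w) ^ 2 + D2 P u w))

/-- The non-robust strategy `π_0(w) = ((mu - r) / sigma²) (c - r w) / ((d - 1) r)`. -/
def pi0 (P : Params) (w : ℝ) : ℝ :=
  (P.mu - P.r) / P.sigma ^ 2 * ((P.c - P.r * w) / ((P.d - 1) * P.r))

end RobustRuin

end

open Set
namespace RobustRuin

/-! Minimising the quadratic in `π` turns the equation into `lam u = (r w - c) u' - R u'² / (ε u'² +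
u'')`. Put `y = w_s - w` and look for `v(y) = u(w)` with `y v' = v K(ε v)`. In the variable `x = ε
v` the profile must satisfy `x K' = 1 - K + R K / (r K - lam) - x K`, an equation free of `ε`, so
one function `K` serves every `ε` in a bounded range. At `x = 0` the right side vanishes for `K =
d`, the exponent of the non-robust solution.

In these terms `π*` is `(mu - r) / sigma² * (w_s - w) (r - lam / K(ε u)) / R`, increasing in the
value of `K`. Monotonicity in `ε` therefore follows from two facts: `K` is antitone
(`exists_profile`), and `ε u(w; ε)` is non-decreasing in `ε` (`mul_value_le_mul_value`). The value
`K 0 = d` gives `π_0`.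

The profile equation is singular at `0`, so `K` is built as a fixed point of a contraction that
preserves antitone functions. The function `v` comes from separating variables. Uniqueness needs no
general comparison principle: the explicit solution is `C²` and is itself a test function against
any other viscosity solution (`IsClassicalSolution.eqOn`). -/

/-! ### Integral operator for an equation singular at `0` -/

/-- Truncation of a real number to `[0, E]`. -/
noncomputable def clamp (E x : ℝ) : ℝ := max 0 (min x E)

lemma continuous_clamp (E : ℝ) : Continuous (clamp E) := by
  unfold clamp; fun_prop

lemma monotone_clamp (E : ℝ) : Monotone (clamp E) := fun x y h => by
  unfold clamp; gcongr

lemma clamp_nonneg (E x : ℝ) : 0 ≤ clamp E x := le_max_left _ _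

lemma clamp_le {E : ℝ} (hE : 0 ≤ E) (x : ℝ) : clamp E x ≤ E := max_le hE (min_le_right _ _)

lemma clamp_of_mem {E x : ℝ} (h : x ∈ Icc 0 E) : clamp E x = x := by
  simp [clamp, h.1, h.2]

/-- The integral operator whose fixed point solves `x K' + (n + 1 + x) K = H (K)` on `[0, E]`. -/
noncomputable def profileOp (n : ℕ) (H : ℝ → ℝ) (E : ℝ) (K : ℝ → ℝ) (x : ℝ) : ℝ :=
  ∫ θ in (0 : ℝ)..1, θ ^ n * Real.exp (-(clamp E x * (1 - θ))) * H (K (clamp E x * θ))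

lemma continuous_profileOp_integrand {n : ℕ} {H : ℝ → ℝ} (hH : Continuous H) (E : ℝ) {K : ℝ → ℝ}
    (hK : Continuous K) : Continuous (Function.uncurry fun x θ : ℝ =>
      θ ^ n * Real.exp (-(clamp E x * (1 - θ))) * H (K (clamp E x * θ))) := by
  have := continuous_clamp E
  unfold Function.uncurry
  fun_prop

lemma continuous_profileOp {n : ℕ} {H : ℝ → ℝ} (hH : Continuous H) (E : ℝ) {K : ℝ → ℝ}
    (hK : Continuous K) : Continuous (profileOp n H E K) :=
  intervalIntegral.continuous_parametric_intervalIntegral_of_continuous'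
    (continuous_profileOp_integrand hH E hK) 0 1

lemma intervalIntegrable_profileOp {n : ℕ} {H : ℝ → ℝ} (hH : Continuous H) (E : ℝ) {K : ℝ → ℝ}
    (hK : Continuous K) (x : ℝ) : IntervalIntegrable (fun θ : ℝ =>
      θ ^ n * Real.exp (-(clamp E x * (1 - θ))) * H (K (clamp E x * θ))) MeasureTheory.volume 0 1 :=
  Continuous.intervalIntegrable (by fun_prop) _ _

lemma integral_pow_mul_const (n : ℕ) (C : ℝ) :
    ∫ θ in (0 : ℝ)..1, θ ^ n * C = C / (n + 1) := by
  rw [intervalIntegral.integral_mul_const, integral_pow]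
  simp; ring

/-- The weight is at most `θ ^ n`, whose integral is `1 / (n + 1)`; `d` acts as a constant
supersolution. -/
lemma profileOp_le {n : ℕ} {H : ℝ → ℝ} (hH : Continuous H) {E : ℝ} {K : ℝ → ℝ}
    (hK : Continuous K) {d : ℝ} (hd : 0 ≤ d) (hHd : ∀ k, H k ≤ (n + 1) * d) (x : ℝ) :
    profileOp n H E K x ≤ d := by
  have : ∫ θ in (0 : ℝ)..1, θ ^ n * ((n + 1) * d) = d := by
    rw [integral_pow_mul_const]; field_simp
  rw [← this]
  refine intervalIntegral.integral_mono_on zero_le_one (intervalIntegrable_profileOp hH E hK x)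
    (Continuous.intervalIntegrable (by fun_prop) _ _) fun θ hθ => ?_
  have h1 : Real.exp (-(clamp E x * (1 - θ))) ≤ 1 := by
    rw [Real.exp_le_one_iff]
    have := mul_nonneg (clamp_nonneg E x) (sub_nonneg.2 hθ.2)
    linarith
  have h0 : 0 ≤ θ ^ n := pow_nonneg hθ.1 n
  have h2 : 0 ≤ (n + 1) * d := by positivity
  have h3 := Real.exp_nonneg (-(clamp E x * (1 - θ)))
  rw [mul_assoc]
  refine mul_le_mul_of_nonneg_left ?_ h0
  calc _ ≤ Real.exp (-(clamp E x * (1 - θ))) * ((n + 1) * d) :=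
        mul_le_mul_of_nonneg_left (hHd _) h3
    _ ≤ _ := mul_le_of_le_one_left h2 h1

/-- The constant `k0` solves the linear equation with right side `(n + 1 + x) k0`, so its integral
representation is exact. On `[0, E]` that right side is at most `(n + 1 + E) k0`, hence at most `H`.
-/
lemma le_profileOp {n : ℕ} {H : ℝ → ℝ} (hH : Continuous H) {E : ℝ} (hE : 0 ≤ E) {K : ℝ → ℝ}
    (hK : Continuous K) {k0 : ℝ} (hk0 : 0 ≤ k0) (hHk : ∀ k, (n + 1 + E) * k0 ≤ H k) (x : ℝ) :
    k0 ≤ profileOp n H E K x := by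
  set a := clamp E x with ha
  have hder : ∀ θ ∈ uIcc (0 : ℝ) 1, HasDerivAt
      (fun θ : ℝ => θ ^ (n + 1) * Real.exp (-(a * (1 - θ))) * k0)
      (θ ^ n * Real.exp (-(a * (1 - θ))) * ((n + 1 + a * θ) * k0)) θ := by
    intro θ _
    have h1 : HasDerivAt (fun θ : ℝ => -(a * (1 - θ))) a θ := by
      have := (((hasDerivAt_id' θ).const_sub 1).const_mul a).fun_neg
      simpa using this
    have := ((hasDerivAt_pow (n + 1) θ).mul h1.exp).mul_const k0
    refine this.congr_deriv ?_
    rw [show n + 1 - 1 = n from rfl]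
    push_cast
    ring
  have hint : ∫ θ in (0 : ℝ)..1, θ ^ n * Real.exp (-(a * (1 - θ))) * ((n + 1 + a * θ) * k0) = k0 := by
    rw [intervalIntegral.integral_eq_sub_of_hasDerivAt hder
      (Continuous.intervalIntegrable (by fun_prop) _ _)]
    simp
  rw [← hint]
  refine intervalIntegral.integral_mono_on zero_le_one
    (Continuous.intervalIntegrable (by fun_prop) _ _) (intervalIntegrable_profileOp hH E hK x)
    fun θ hθ => ?_
  have h0 : 0 ≤ θ ^ n := pow_nonneg hθ.1 n
  have h3 := Real.exp_nonneg (-(a * (1 - θ)))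
  refine mul_le_mul_of_nonneg_left (le_trans ?_ (hHk _)) (mul_nonneg h0 h3)
  have : a * θ ≤ E := (mul_le_of_le_one_right (clamp_nonneg E x) hθ.2).trans (clamp_le hE x)
  gcongr

/-- After scaling to `θ ∈ [0, 1]`, both `exp (-x (1 - θ))` and `H (K (x θ))` decrease in `x`. -/
lemma antitone_profileOp {n : ℕ} {H : ℝ → ℝ} (hH : Continuous H) (hm : Monotone H)
    (h0 : ∀ k, 0 ≤ H k) {E : ℝ} {K : ℝ → ℝ} (hK : Continuous K) (hKa : Antitone K) :
    Antitone (profileOp n H E K) := by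
  intro x y hxy
  refine intervalIntegral.integral_mono_on zero_le_one (intervalIntegrable_profileOp hH E hK y)
    (intervalIntegrable_profileOp hH E hK x) fun θ hθ => ?_
  have h0' : 0 ≤ θ ^ n := pow_nonneg hθ.1 n
  have hc := monotone_clamp E hxy
  have h1 : 0 ≤ 1 - θ := sub_nonneg.2 hθ.2
  have h2 : H (K (clamp E y * θ)) ≤ H (K (clamp E x * θ)) :=
    hm (hKa (mul_le_mul_of_nonneg_right hc hθ.1))
  have := h0 (K (clamp E y * θ))
  gcongr

/-- The Lipschitz constant `n` of `H` meets the mass `1 / (n + 1)` of `θ ^ n`, so the operator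
contracts for every `n`. -/
lemma abs_profileOp_sub_le {n : ℕ} {H : ℝ → ℝ} (hH : Continuous H)
    (hL : ∀ a b, |H a - H b| ≤ n * |a - b|) {E : ℝ} {K K' : ℝ → ℝ} (hK : Continuous K)
    (hK' : Continuous K') {C : ℝ} (hC : ∀ x, |K x - K' x| ≤ C) (x : ℝ) :
    |profileOp n H E K x - profileOp n H E K' x| ≤ n / (n + 1) * C := by
  have hint : ∫ θ in (0 : ℝ)..1, θ ^ n * (n * C) = n / (n + 1) * C := by
    rw [integral_pow_mul_const]; ring
  unfold profileOp
  rw [← intervalIntegral.integral_sub (intervalIntegrable_profileOp hH E hK x)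
    (intervalIntegrable_profileOp hH E hK' x), ← hint, ← Real.norm_eq_abs]
  refine intervalIntegral.norm_integral_le_of_norm_le zero_le_one ?_
    (Continuous.intervalIntegrable (by fun_prop) _ _)
  refine Filter.Eventually.of_forall fun θ hθ => ?_
  rw [← mul_sub, Real.norm_eq_abs, abs_mul, abs_mul, abs_of_nonneg (pow_nonneg hθ.1.le n),
    abs_of_nonneg (Real.exp_nonneg _), mul_assoc]
  have h1 : Real.exp (-(clamp E x * (1 - θ))) ≤ 1 := by
    rw [Real.exp_le_one_iff]
    have := mul_nonneg (clamp_nonneg E x) (sub_nonneg.2 hθ.2)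
    linarith
  refine mul_le_mul_of_nonneg_left ?_ (pow_nonneg hθ.1.le n)
  calc _ ≤ 1 * |H (K (clamp E x * θ)) - H (K' (clamp E x * θ))| := by gcongr
    _ ≤ _ := by
      rw [one_mul]
      exact (hL _ _).trans (mul_le_mul_of_nonneg_left (hC _) n.cast_nonneg)

open BoundedContinuousFunction in
/-- The fixed point of `profileOp`. -/
lemma exists_profileOp_fixedPoint {n : ℕ} {H : ℝ → ℝ} (hH : Continuous H) (hm : Monotone H)
    (hL : ∀ a b, |H a - H b| ≤ n * |a - b|) {E : ℝ} (hE : 0 ≤ E) {k0 d : ℝ} (hk0 : 0 ≤ k0)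
    (hd : 0 ≤ d) (hHk : ∀ k, (n + 1 + E) * k0 ≤ H k) (hHd : ∀ k, H k ≤ (n + 1) * d) :
    ∃ K : ℝ → ℝ, Continuous K ∧ Antitone K ∧ (∀ x, k0 ≤ K x ∧ K x ≤ d) ∧
      ∀ x, K x = profileOp n H E K x := by
  let T : (ℝ →ᵇ ℝ) → (ℝ →ᵇ ℝ) := fun K =>
    BoundedContinuousFunction.ofNormedAddCommGroup (profileOp n H E K)
      (continuous_profileOp hH E K.continuous) d fun x => by
        rw [Real.norm_eq_abs, abs_of_nonneg (hk0.trans (le_profileOp hH hE K.continuous hk0 hHk x))]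
        exact profileOp_le hH K.continuous hd hHd x
  have hT : ∀ K x, T K x = profileOp n H E K x := fun _ _ => rfl
  let q : NNReal := ⟨(n : ℝ) / (n + 1), by positivity⟩
  have hcontr : ContractingWith q T := by
    refine ⟨?_, LipschitzWith.of_dist_le_mul fun K K' => ?_⟩
    · rw [← NNReal.coe_lt_coe]
      change (n : ℝ) / (n + 1) < 1
      rw [div_lt_one (by positivity)]
      linarith
    · rw [BoundedContinuousFunction.dist_le (by positivity)]
      intro x
      rw [Real.dist_eq, hT, hT]
      exact abs_profileOp_sub_le hH hL K.continuous K'.continuous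
        (fun z => by rw [← Real.dist_eq]; exact BoundedContinuousFunction.dist_coe_le_dist z) x
  obtain ⟨K, hTK, htend⟩ : ∃ K : ℝ →ᵇ ℝ, T K = K ∧
      Filter.Tendsto (fun m => T^[m] 0) Filter.atTop (nhds K) :=
    ⟨_, hcontr.fixedPoint_isFixedPt, hcontr.tendsto_iterate_fixedPoint 0⟩
  have hfix : ∀ x, K x = profileOp n H E K x := fun x => by
    conv_lhs => rw [← hTK]
    rfl
  refine ⟨K, K.continuous, ?_, fun x => ?_, hfix⟩
  -- The fixed point is the limit of the iterates from `0`, and antitone functions form a closed set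
  -- that the operator preserves.
  · have hcl : IsClosed {K : ℝ →ᵇ ℝ | Antitone K} :=
      isClosed_antitone.preimage
        BoundedContinuousFunction.continuous_coe
    refine hcl.mem_of_tendsto htend (Filter.Eventually.of_forall fun m => ?_)
    induction m with
    | zero => exact fun _ _ _ => le_rfl
    | succ m ih =>
      rw [Function.iterate_succ_apply']
      exact antitone_profileOp hH hm (fun k => (by positivity : 0 ≤ ((n : ℝ) + 1 + E) * k0).trans
        (hHk k)) (T^[m] 0).continuous ih
  · rw [hfix]
    exact ⟨le_profileOp hH hE K.continuous hk0 hHk x, profileOp_le hH K.continuous hd hHd x⟩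

/-- Substituting `t = x θ` gives `x ^ (n + 1) e ^ x K = ∫₀ˣ t ^ n e ^ t H (K t)`, the equation in
integrating-factor form. -/
lemma hasDerivAt_profileOp_fixedPoint {n : ℕ} {H : ℝ → ℝ} (hH : Continuous H) {E : ℝ} {K : ℝ → ℝ}
    (hK : Continuous K) (hfix : ∀ x, K x = profileOp n H E K x) {x : ℝ} (hx : x ∈ Ioo 0 E) :
    HasDerivAt K ((H (K x) - (n + 1 + x) * K x) / x) x := by
  have hform : ∀ z ∈ Ioo 0 E, K z = (z ^ (n + 1))⁻¹ * Real.exp (-z) *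
      ∫ t in (0 : ℝ)..z, t ^ n * Real.exp t * H (K t) := by
    intro z hz
    have hz0 : z ≠ 0 := hz.1.ne'
    rw [hfix z, profileOp, clamp_of_mem ⟨hz.1.le, hz.2.le⟩]
    have := intervalIntegral.smul_integral_comp_mul_left (a := 0) (b := 1)
      (fun t => t ^ n * Real.exp t * H (K t)) z
    rw [mul_zero, mul_one] at this
    rw [← this, smul_eq_mul, ← intervalIntegral.integral_const_mul,
      ← intervalIntegral.integral_const_mul]
    refine intervalIntegral.integral_congr fun θ _ => ?_
    have he : Real.exp (-(z * (1 - θ))) = Real.exp (-z) * Real.exp (z * θ) := by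
      rw [← Real.exp_add]; ring_nf
    simp only [he]
    field_simp
    ring
  have hcont : Continuous fun t : ℝ => t ^ n * Real.exp t * H (K t) := by fun_prop
  have hint := intervalIntegral.integral_hasDerivAt_right
    (hcont.intervalIntegrable 0 x) (hcont.stronglyMeasurableAtFilter _ _) hcont.continuousAt
  have hx0 : x ≠ 0 := hx.1.ne'
  have hpow := (hasDerivAt_pow (n + 1) x).fun_inv (pow_ne_zero _ hx0)
  have hexp : HasDerivAt (fun z : ℝ => Real.exp (-z)) (-Real.exp (-x)) x := by
    simpa using (hasDerivAt_neg x).exp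
  have hprod := (hpow.mul hexp).mul hint
  have hev : K =ᶠ[nhds x] fun z => (z ^ (n + 1))⁻¹ * Real.exp (-z) *
      ∫ t in (0 : ℝ)..z, t ^ n * Real.exp t * H (K t) :=
    Filter.eventually_of_mem (Ioo_mem_nhds hx.1 hx.2) hform
  refine (hprod.congr_of_eventuallyEq hev).congr_deriv ?_
  have hKx := hform x hx
  set I := ∫ t in (0 : ℝ)..x, t ^ n * Real.exp t * H (K t)
  have hee : Real.exp (-x) = (Real.exp x)⁻¹ := Real.exp_neg x
  have hI : I = K x * x ^ (n + 1) * Real.exp x := by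
    rw [hKx, hee]; field_simp
  simp only [hI, hee, Pi.mul_apply]
  rw [show n + 1 - 1 = n from rfl]
  push_cast
  field_simp
  ring

/-! ### The profile `K` -/

/-- The logarithmic derivative of the value function, as a function of `ε` times its value. It
solves a differential equation which is singular at `0`. -/
lemma exists_profile {r lam R d E : ℝ} (hr : 0 < r) (hl : 0 < lam) (hR : 0 < R) (hd : 1 < d)
    (hdl : (d - 1) * (r * d - lam) = R * d) (hE : 0 ≤ E) :
    ∃ (K : ℝ → ℝ) (k0 : ℝ), Continuous K ∧ Antitone K ∧ 0 < k0 ∧ lam < r * k0 ∧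
      (∀ x, k0 ≤ K x ∧ K x ≤ d) ∧ K 0 = d ∧
      ∀ x ∈ Ioo 0 E, HasDerivAt K ((1 - K x + R * K x / (r * K x - lam) - x * K x) / x) x := by
  -- With this `k0`, `R k0 / (r k0 - lam) = (1 + E) k0`, which makes `k0` a constant subsolution on
  -- `[0, E]`.
  obtain ⟨k0, hk⟩ : ∃ k0, r * k0 - lam = R / (1 + E) := ⟨(lam + R / (1 + E)) / r, by field_simp; ring⟩
  have hδ : 0 < R / (1 + E) := by positivity
  have hk0 : 0 < k0 := by
    by_contra h
    nlinarith
  have hdR : R < r * d - lam := by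
    by_contra h
    push Not at h
    nlinarith
  have hRE : R / (1 + E) ≤ R := div_le_self hR.le (by linarith)
  have hkd : k0 ≤ d := by
    by_contra h
    push Not at h
    nlinarith
  -- `R k / (r k - lam)` decreases in `k` at rate at most `R lam / (r k0 - lam)²` for `k ≥ k0`.
  -- Adding `n k` to both sides of the equation makes the nonlinearity non-decreasing and
  -- `n`-Lipschitz.
  obtain ⟨n, hn⟩ := exists_nat_ge (R * lam / (R / (1 + E)) ^ 2)
  have hn' : R * lam ≤ n * (R / (1 + E)) ^ 2 := (div_le_iff₀ (by positivity)).1 hn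
  -- Clipping to `[k0, d]` makes the bounds on `G` global; it has no effect on the fixed point,
  -- which takes values there.
  let κ : ℝ → ℝ := fun k => max k0 (min k d)
  have hκ0 : ∀ k, k0 ≤ κ k := fun k => le_max_left _ _
  have hκd : ∀ k, κ k ≤ d := fun k => max_le hkd (min_le_right _ _)
  have hκm : Monotone κ := fun a b h => by simp only [κ]; gcongr
  have hκc : Continuous κ := by simp only [κ]; fun_prop
  have hκL : ∀ a b, |κ a - κ b| ≤ |a - b| := fun a b =>
    (abs_max_sub_max_le_max k0 (min a d) k0 (min b d)).trans (by
      simpa using abs_min_sub_min_le_max a d b d)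
  have hκid : ∀ k, k0 ≤ k → k ≤ d → κ k = k := fun k h1 h2 => by simp [κ, h1, h2]
  let G : ℝ → ℝ := fun k => 1 + R * k / (r * k - lam) + n * k
  have hpos : ∀ k, k0 ≤ k → R / (1 + E) ≤ r * k - lam := fun k h => by
    rw [← hk]; gcongr
  have hGdiff : ∀ a b, k0 ≤ a → a ≤ b → 0 ≤ G b - G a ∧ G b - G a ≤ n * (b - a) := by
    intro a b ha hab
    have h1 := hpos a ha
    have h2 := hpos b (ha.trans hab)
    have h1' : 0 < r * a - lam := hδ.trans_le h1
    have h2' : 0 < r * b - lam := hδ.trans_le h2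
    have e : G b - G a = (n - R * lam / ((r * a - lam) * (r * b - lam))) * (b - a) := by
      have n1 : a * r - lam ≠ 0 := by rw [mul_comm]; exact h1'.ne'
      have n2 : b * r - lam ≠ 0 := by rw [mul_comm]; exact h2'.ne'
      simp only [G, mul_comm r]; field_simp; ring
    have hq : R * lam / ((r * a - lam) * (r * b - lam)) ≤ n := by
      rw [div_le_iff₀ (by positivity)]
      refine hn'.trans (mul_le_mul_of_nonneg_left ?_ n.cast_nonneg)
      rw [sq]
      exact mul_le_mul h1 h2 hδ.le h1'.le
    have hq0 : 0 ≤ R * lam / ((r * a - lam) * (r * b - lam)) := by positivity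
    rw [e]
    exact ⟨mul_nonneg (sub_nonneg.2 hq) (sub_nonneg.2 hab),
      mul_le_mul_of_nonneg_right (by linarith) (sub_nonneg.2 hab)⟩
  have hGd : G d = (n + 1) * d := by
    have : R * d / (r * d - lam) = d - 1 := by
      rw [← hdl, mul_div_assoc, div_self (hR.trans hdR).ne', mul_one]
    simp only [G, this]; ring
  have hGk : (n + 1 + E) * k0 ≤ G k0 := by
    simp only [G, hk]
    have : R * k0 / (R / (1 + E)) = (1 + E) * k0 := by field_simp
    rw [this]; linarith
  obtain ⟨K, hKc, hKa, hKb, hfix⟩ := exists_profileOp_fixedPoint (n := n) (H := fun k => G (κ k))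
    (E := E) (k0 := k0) (d := d) (by
      have : ∀ k, r * κ k - lam ≠ 0 := fun k => (hδ.trans_le (hpos _ (hκ0 k))).ne'
      simp only [G]; fun_prop (disch := assumption))
    (fun a b h => by
      have := (hGdiff _ _ (hκ0 a) (hκm h)).1
      simp only; linarith)
    (by
      have key : ∀ a b, a ≤ b → |G (κ a) - G (κ b)| ≤ n * |a - b| := fun a b h => by
        obtain ⟨h1, h2⟩ := hGdiff _ _ (hκ0 a) (hκm h)
        rw [abs_sub_comm, abs_of_nonneg h1]
        refine h2.trans (mul_le_mul_of_nonneg_left ?_ n.cast_nonneg)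
        have := hκL b a
        rw [abs_sub_comm a b]
        exact (le_abs_self _).trans this
      intro a b
      rcases le_total a b with h | h
      · exact key a b h
      · rw [abs_sub_comm, abs_sub_comm a b]; exact key b a h)
    hE hk0.le (by linarith)
    (fun k => by
      have := (hGdiff _ _ le_rfl (hκ0 k)).1
      linarith)
    (fun k => by
      have := (hGdiff _ _ (hκ0 k) (hκd k)).1
      linarith)
  have hGc : Continuous fun k => G (κ k) := by
    have : ∀ k, r * κ k - lam ≠ 0 := fun k => (hδ.trans_le (hpos _ (hκ0 k))).ne'
    simp only [G]; fun_prop (disch := assumption)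
  refine ⟨K, k0, hKc, hKa, hk0, by linarith, hKb, ?_, fun x hx => ?_⟩
  -- At `x = 0` the fixed-point equation reads `(n + 1) K 0 = G (K 0)`. Together with `G d = (n + 1)
  -- d` and the Lipschitz constant `n`, this forces `d ≤ K 0`.
  · have h0 := hfix 0
    have : clamp E 0 = 0 := clamp_of_mem ⟨le_rfl, hE⟩
    simp only [profileOp, this, zero_mul, neg_zero, Real.exp_zero, mul_one] at h0
    rw [integral_pow_mul_const, hκid _ (hKb 0).1 (hKb 0).2, eq_div_iff (by positivity)] at h0
    have h1 := (hGdiff _ _ (hKb 0).1 (hKb 0).2).2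
    have h2 := (hKb 0).2
    rw [hGd, ← h0] at h1
    nlinarith
  · refine (hasDerivAt_profileOp_fixedPoint hGc hKc hfix hx).congr_deriv ?_
    rw [hκid _ (hKb x).1 (hKb x).2]
    simp only [G]
    ring

/-! ### Separation of variables and comparison in `ε` -/

/-- The autonomous equation `l' = g(l)` with `g` bounded between positive constants. -/
lemma exists_flow {g : ℝ → ℝ} (hg : Continuous g) {k0 d : ℝ} (hk0 : 0 < k0)
    (hb : ∀ s, k0 ≤ g s ∧ g s ≤ d) :
    ∃ l : ℝ → ℝ, l 0 = 0 ∧ (∀ t, HasDerivAt l (g (l t)) t) ∧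
      ∀ t, ∫ s in (0 : ℝ)..l t, (g s)⁻¹ = t := by
  have hpos : ∀ s, 0 < g s := fun s => hk0.trans_le (hb s).1
  have hd : 0 < d := (hpos 0).trans_le (hb 0).2
  have hc : Continuous fun s => (g s)⁻¹ := hg.inv₀ fun s => (hpos s).ne'
  -- The solution is the inverse of `Φ`, so continuity of `g` suffices. The bound `g ≤ d` gives `Φ`
  -- slope at least `1 / d`, hence surjectivity.
  set Φ : ℝ → ℝ := fun x => ∫ s in (0 : ℝ)..x, (g s)⁻¹ with hΦ
  have hder : ∀ x, HasDerivAt Φ (g x)⁻¹ x := fun x =>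
    intervalIntegral.integral_hasDerivAt_right (hc.intervalIntegrable 0 x)
      (hc.stronglyMeasurableAtFilter _ _) hc.continuousAt
  have hΦ0 : Φ 0 = 0 := by simp [hΦ]
  have hmono : StrictMono Φ := strictMono_of_deriv_pos fun x => by
    rw [(hder x).deriv]; exact inv_pos.2 (hpos x)
  have hcont : Continuous Φ := continuous_iff_continuousAt.2 fun x => (hder x).continuousAt
  have hlin : Monotone fun x => Φ x - x / d := by
    have h1 : ∀ x, HasDerivAt (fun x => Φ x - x / d) ((g x)⁻¹ - 1 / d) x := fun x =>
      (hder x).sub ((hasDerivAt_id' x).div_const d)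
    refine monotone_of_deriv_nonneg (fun x => (h1 x).differentiableAt) fun x => ?_
    rw [(h1 x).deriv, one_div, sub_nonneg]
    exact inv_anti₀ (hpos x) (hb x).2
  have htop : Filter.Tendsto Φ Filter.atTop Filter.atTop := by
    refine Filter.tendsto_atTop_mono' _ ?_ (Filter.tendsto_id.atTop_div_const hd)
    filter_upwards [Filter.eventually_ge_atTop 0] with x hx
    have := hlin hx
    simp only [hΦ0, zero_div, sub_zero] at this
    simp only [id]
    linarith
  have hbot : Filter.Tendsto Φ Filter.atBot Filter.atBot := by
    refine Filter.tendsto_atBot_mono' _ ?_ (Filter.tendsto_id.atBot_div_const hd)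
    filter_upwards [Filter.eventually_le_atBot 0] with x hx
    have := hlin hx
    simp only [hΦ0, zero_div, sub_zero] at this
    simp only [id]
    linarith
  have hsurj : Function.Surjective Φ := hcont.surjective htop hbot
  let e := hmono.orderIsoOfSurjective Φ hsurj
  have hΦe : ∀ t, Φ (e.symm t) = t := fun t => e.apply_symm_apply t
  refine ⟨e.symm, hmono.injective (by rw [hΦe, hΦ0]), fun t => ?_, hΦe⟩
  have := HasDerivAt.of_local_left_inverse (f := Φ) (g := e.symm) (a := t)
    e.symm.continuous.continuousAt (hder _) (inv_ne_zero (hpos _).ne')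
    (Filter.Eventually.of_forall hΦe)
  simpa using this

/-- The solution of `y v' = v K(ε v)`, `v(Y) = 1`. -/
lemma exists_value {K : ℝ → ℝ} (hK : Continuous K) {k0 d : ℝ} (hk0 : 0 < k0)
    (hb : ∀ s, k0 ≤ K s ∧ K s ≤ d) {Y : ℝ} (hY : 0 < Y) (ε : ℝ) :
    ∃ v : ℝ → ℝ, v Y = 1 ∧ ∀ y, 0 < y → 0 < v y ∧ HasDerivAt v (v y * K (ε * v y) / y) y ∧
      (y ≤ Y → v y ≤ (y / Y) ^ k0) ∧
      ∫ s in (0 : ℝ)..Real.log (v y), (K (ε * Real.exp s))⁻¹ = Real.log (y / Y) := by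
  -- In the variables `l = log v` and `t = log (y / Y)` the equation is autonomous: `l' = K (ε e ^
  -- l)`.
  obtain ⟨l, hl0, hl, hint⟩ := exists_flow (g := fun s => K (ε * Real.exp s)) (by fun_prop) hk0
    (fun s => hb _)
  have hdecay : ∀ t ≤ 0, l t ≤ k0 * t := by
    have hm : Monotone fun t => l t - k0 * t := by
      have h1 : ∀ t, HasDerivAt (fun t => l t - k0 * t) (K (ε * Real.exp (l t)) - k0 * 1) t :=
        fun t => (hl t).sub ((hasDerivAt_id' t).const_mul k0)
      refine monotone_of_deriv_nonneg (fun x => (h1 x).differentiableAt) fun x => ?_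
      rw [(h1 x).deriv]
      linarith [(hb (ε * Real.exp (l x))).1]
    intro t ht
    have := hm ht
    simp only [hl0] at this
    linarith
  refine ⟨fun y => Real.exp (l (Real.log (y / Y))), by simp [hY.ne', hl0], fun y hy =>
    ⟨Real.exp_pos _, ?_, fun hyY => ?_, ?_⟩⟩
  · have h1 : HasDerivAt (fun y => Real.log (y / Y)) (1 / y) y := by
      refine (((hasDerivAt_id' y).div_const Y).log (div_pos hy hY).ne').congr_deriv ?_
      field_simp
    refine ((hl _).comp y h1).exp.congr_deriv ?_
    simp only [Function.comp]
    ring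
  · have ht : Real.log (y / Y) ≤ 0 := Real.log_nonpos (div_pos hy hY).le ((div_le_one hY).2 hyY)
    rw [Real.rpow_def_of_pos (div_pos hy hY), Real.exp_le_exp, mul_comm]
    exact hdecay _ ht
  · simp only [Real.log_exp]
    exact hint _

/-- Comparison of `ε v` for two values of `ε`. -/
lemma mul_value_le_mul_value {K : ℝ → ℝ} (hK : Continuous K) (hpos : ∀ s, 0 < K s)
    {ε₁ ε₂ v₁ v₂ : ℝ} (h1 : 0 ≤ ε₁) (h12 : ε₁ ≤ ε₂) (hv₁ : 0 < v₁) (hv₂ : 0 < v₂)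
    (hint : ∫ s in (0 : ℝ)..Real.log v₁, (K (ε₁ * Real.exp s))⁻¹ =
      ∫ s in (0 : ℝ)..Real.log v₂, (K (ε₂ * Real.exp s))⁻¹) :
    ε₁ * v₁ ≤ ε₂ * v₂ := by
  rcases h1.eq_or_lt with rfl | h1
  · rw [zero_mul]; positivity
  have h2 : 0 < ε₂ := h1.trans_le h12
  set g : ℝ → ℝ := fun s => (K (Real.exp s))⁻¹ with hg
  have hgc : Continuous g := by
    have : Continuous fun s => K (Real.exp s) := by fun_prop
    exact this.inv₀ fun s => (hpos _).ne'
  -- Translating by `log ε` removes `ε` from the integrand: equal integrals of one positive function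
  -- then start at `log ε` and end at `log (ε v)`, so a later start forces a later end.
  have hshift : ∀ ε v : ℝ, 0 < ε → 0 < v →
      ∫ s in (0 : ℝ)..Real.log v, (K (ε * Real.exp s))⁻¹ =
        ∫ s in Real.log ε..Real.log (ε * v), g s := by
    intro ε v hε hv
    have := intervalIntegral.integral_comp_add_right (a := 0) (b := Real.log v) g (Real.log ε)
    rw [zero_add, add_comm (Real.log v), ← Real.log_mul hε.ne' hv.ne'] at this
    rw [← this]
    refine intervalIntegral.integral_congr fun s _ => ?_
    simp only [hg, Real.exp_add, Real.exp_log hε, mul_comm]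
  rw [hshift _ _ h1 hv₁, hshift _ _ h2 hv₂] at hint
  by_contra hlt
  push Not at hlt
  have hii : ∀ a b, IntervalIntegrable g MeasureTheory.volume a b :=
    fun a b => hgc.intervalIntegrable a b
  have hlog : Real.log (ε₂ * v₂) < Real.log (ε₁ * v₁) := Real.log_lt_log (by positivity) hlt
  have hloge : Real.log ε₁ ≤ Real.log ε₂ := Real.log_le_log h1 h12
  have e1 := intervalIntegral.integral_add_adjacent_intervals
    (hii (Real.log ε₁) (Real.log ε₂)) (hii (Real.log ε₂) (Real.log (ε₂ * v₂)))
  have e2 := intervalIntegral.integral_add_adjacent_intervals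
    (hii (Real.log ε₁) (Real.log (ε₂ * v₂))) (hii (Real.log (ε₂ * v₂)) (Real.log (ε₁ * v₁)))
  have p1 : 0 ≤ ∫ s in Real.log ε₁..Real.log ε₂, g s :=
    intervalIntegral.integral_nonneg hloge fun s _ => (inv_pos.2 (hpos _)).le
  have p2 : 0 < ∫ s in Real.log (ε₂ * v₂)..Real.log (ε₁ * v₁), g s :=
    intervalIntegral.intervalIntegral_pos_of_pos (hii _ _) (fun s => inv_pos.2 (hpos _)) hlog
  linarith

/-! ### Minimisation of the Hamiltonian -/

variable {P : Params}

lemma ham_eq_add_sq (hs : P.sigma ≠ 0) {ε p A : ℝ} (hq : 0 < ε * p ^ 2 + A) (w π : ℝ) :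
    ham P ε w p A π = (P.r * w - P.c) * p - P.R * p ^ 2 / (ε * p ^ 2 + A) +
      1 / 2 * P.sigma ^ 2 * (ε * p ^ 2 + A) *
        (π - -((P.mu - P.r) / P.sigma ^ 2) * (p / (ε * p ^ 2 + A))) ^ 2 := by
  unfold ham Params.R
  generalize ε * p ^ 2 + A = q at hq ⊢
  field_simp
  ring

lemma ham_ge (hs : P.sigma ≠ 0) {ε p A : ℝ} (hq : 0 < ε * p ^ 2 + A) (w π : ℝ) :
    (P.r * w - P.c) * p - P.R * p ^ 2 / (ε * p ^ 2 + A) ≤ ham P ε w p A π := by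
  rw [ham_eq_add_sq hs hq]
  have : 0 ≤ 1 / 2 * P.sigma ^ 2 * (ε * p ^ 2 + A) *
        (π - -((P.mu - P.r) / P.sigma ^ 2) * (p / (ε * p ^ 2 + A))) ^ 2 := by positivity
  linarith

lemma ham_optimal (hs : P.sigma ≠ 0) {ε p A : ℝ} (hq : 0 < ε * p ^ 2 + A) (w : ℝ) :
    ham P ε w p A (-((P.mu - P.r) / P.sigma ^ 2) * (p / (ε * p ^ 2 + A))) =
      (P.r * w - P.c) * p - P.R * p ^ 2 / (ε * p ^ 2 + A) := by
  rw [ham_eq_add_sq hs hq]; ring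

lemma F_eq_coe (hs : P.sigma ≠ 0) {ε p A : ℝ} (hq : 0 < ε * p ^ 2 + A) (w z : ℝ) :
    F P ε w z p A =
      ((P.lam * z - ((P.r * w - P.c) * p - P.R * p ^ 2 / (ε * p ^ 2 + A)) : ℝ) : EReal) := by
  have : ⨅ π : ℝ, ((ham P ε w p A π : ℝ) : EReal) =
      (((P.r * w - P.c) * p - P.R * p ^ 2 / (ε * p ^ 2 + A) : ℝ) : EReal) := by
    refine le_antisymm ?_ (le_iInf fun π => EReal.coe_le_coe_iff.2 (ham_ge hs hq w π))
    rw [← ham_optimal hs hq w]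
    exact iInf_le (fun π : ℝ => ((ham P ε w p A π : ℝ) : EReal)) _
  rw [F, this, ← EReal.coe_sub]

/-- Degenerate ellipticity: the coefficient of `A` in `ham` is `sigma² π² / 2 ≥ 0`. -/
lemma F_anti (ε w z p : ℝ) {A A' : ℝ} (h : A ≤ A') : F P ε w z p A' ≤ F P ε w z p A := by
  refine EReal.sub_le_sub le_rfl (iInf_mono fun π => EReal.coe_le_coe_iff.2 ?_)
  unfold ham
  gcongr

/-! ### Test functions and uniqueness -/

/-- First and second order conditions at a local maximum of a difference. -/
lemma deriv_conditions_of_isLocalMax_sub {f g : ℝ → ℝ} {s : Set ℝ} (hs : IsOpen s)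
    (hf : ContDiffOn ℝ 2 f s) (hg : ContDiffOn ℝ 2 g s) {w : ℝ} (hw : w ∈ s)
    (h : IsLocalMax (fun x => f x - g x) w) :
    deriv f w = deriv g w ∧ deriv (deriv f) w ≤ deriv (deriv g) w := by
  have hd : ∀ {f : ℝ → ℝ}, ContDiffOn ℝ 2 f s → ∀ x ∈ s, DifferentiableAt ℝ f x :=
    fun hf x hx => (hf.differentiableOn two_ne_zero).differentiableAt (hs.mem_nhds hx)
  have hd2 : ∀ {f : ℝ → ℝ}, ContDiffOn ℝ 2 f s → DifferentiableAt ℝ (deriv f) w := fun hf => by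
    have : ContDiffOn ℝ (1 + 1) _ s := hf
    exact (((contDiffOn_succ_iff_deriv_of_isOpen hs).1 this).2.2.differentiableOn
      one_ne_zero).differentiableAt (hs.mem_nhds hw)
  have e1 : ∀ x ∈ s, deriv (fun x => f x - g x) x = deriv f x - deriv g x := fun x hx =>
    deriv_fun_sub (hd hf x hx) (hd hg x hx)
  have e2 : deriv (deriv fun x => f x - g x) w = deriv (deriv f) w - deriv (deriv g) w := by
    rw [Filter.EventuallyEq.deriv_eq (Filter.eventually_of_mem (hs.mem_nhds hw) e1)]
    exact deriv_fun_sub (hd2 hf) (hd2 hg)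
  have h1 := h.deriv_eq_zero
  refine ⟨by rw [e1 w hw] at h1; linarith, ?_⟩
  -- A positive second derivative would make `w` a local minimum too, so the difference would be
  -- locally constant.
  by_contra! hlt
  have hmin : IsLocalMin (fun x => f x - g x) w :=
    isLocalMin_of_deriv_deriv_pos (by rw [e2]; linarith) h1
      ((hd hf w hw).continuousAt.sub (hd hg w hw).continuousAt)
  have hconst : (fun x => f x - g x) =ᶠ[nhds w] fun _ => f w - g w := by
    filter_upwards [h, hmin] with x hx hx' using le_antisymm hx hx'
  have : deriv (deriv fun x => f x - g x) w = 0 := by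
    rw [hconst.deriv.deriv_eq]
    simp
  rw [e2] at this
  linarith

/-- `u` is a strictly convex, in the sense of the equation, classical solution in `(b, w_s)`. -/
structure IsClassicalSolution (P : Params) (ε : ℝ) (u : ℝ → ℝ) : Prop where
  contDiffOn : ContDiffOn ℝ 2 u (Ioo P.b P.ws)
  pos : ∀ w ∈ Ioo P.b P.ws, 0 < ε * deriv u w ^ 2 + deriv (deriv u) w
  eq : ∀ w ∈ Ioo P.b P.ws, P.lam * u w = (P.r * w - P.c) * deriv u w -
    P.R * deriv u w ^ 2 / (ε * deriv u w ^ 2 + deriv (deriv u) w)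

/-- Only the zeroth-order slot is free, so `F` measures the gap between `z` and `u w`. This is what
lets `u` serve as test function for another solution. -/
lemma IsClassicalSolution.F_eq (hP : P.Admissible) {ε : ℝ} {u : ℝ → ℝ}
    (h : IsClassicalSolution P ε u) {w : ℝ} (hw : w ∈ Ioo P.b P.ws) (z : ℝ) :
    F P ε w z (deriv u w) (deriv (deriv u) w) = ((P.lam * (z - u w) : ℝ) : EReal) := by
  rw [F_eq_coe hP.sigma_pos.ne' (h.pos w hw), ← h.eq w hw, mul_sub]

lemma IsClassicalSolution.isViscositySubsolution (hP : P.Admissible) {ε : ℝ} {u : ℝ → ℝ}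
    (h : IsClassicalSolution P ε u) : IsViscositySubsolution P ε u := by
  intro φ hφ w hw hmax
  obtain ⟨h1, h2⟩ := deriv_conditions_of_isLocalMax_sub isOpen_Ioo h.contDiffOn hφ hw hmax
  rw [← h1]
  refine (F_anti _ _ _ _ h2).trans ?_
  rw [h.F_eq hP hw]
  simp

lemma IsClassicalSolution.isViscositySupersolution (hP : P.Admissible) {ε : ℝ} {u : ℝ → ℝ}
    (h : IsClassicalSolution P ε u) : IsViscositySupersolution P ε u := by
  intro φ hφ w hw hmin
  have hmax : IsLocalMax (fun x => φ x - u x) w := by simpa using hmin.neg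
  obtain ⟨h1, h2⟩ := deriv_conditions_of_isLocalMax_sub isOpen_Ioo hφ h.contDiffOn hw hmax
  rw [h1]
  refine le_trans ?_ (F_anti _ _ _ _ h2)
  rw [h.F_eq hP hw]
  simp

/-- A classical solution is the only viscosity solution: it serves as a test function. -/
lemma IsClassicalSolution.eqOn (hP : P.Admissible) {ε : ℝ} {u v : ℝ → ℝ}
    (h : IsClassicalSolution P ε u) (hu : IsDirichletSolution P ε u)
    (hv : IsDirichletSolution P ε v) : EqOn v u (Icc P.b P.ws) := by
  have hb : P.b ≤ P.ws := hP.b_lt.le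
  have hne : (Icc P.b P.ws).Nonempty := nonempty_Icc.2 hb
  have hc : ContinuousOn (fun x => v x - u x) (Icc P.b P.ws) := hv.continuousOn.sub hu.continuousOn
  have hbd : ∀ w ∈ Icc P.b P.ws, w ∉ Ioo P.b P.ws → v w - u w = 0 := by
    intro w hw hw'
    rcases hw.1.eq_or_lt with rfl | h1
    · rw [hv.left, hu.left, sub_self]
    · rcases hw.2.eq_or_lt with rfl | h2
      · rw [hv.right, hu.right, sub_self]
      · exact absurd ⟨h1, h2⟩ hw'
  have hle : ∀ x ∈ Icc P.b P.ws, v x - u x ≤ 0 := by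
    obtain ⟨w, hw, hmax⟩ := isCompact_Icc.exists_isMaxOn hne hc
    refine fun x hx => (hmax hx).trans ?_
    change v w - u w ≤ 0
    by_cases hw' : w ∈ Ioo P.b P.ws
    · have := hv.sub u h.contDiffOn w hw' (hmax.isLocalMax (Icc_mem_nhds hw'.1 hw'.2))
      rw [h.F_eq hP hw', EReal.coe_nonpos] at this
      exact nonpos_of_mul_nonpos_right this hP.lam_pos
    · exact (hbd w hw hw').le
  have hge : ∀ x ∈ Icc P.b P.ws, 0 ≤ v x - u x := by
    obtain ⟨w, hw, hmin⟩ := isCompact_Icc.exists_isMinOn hne hc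
    refine fun x hx => le_trans ?_ (hmin hx)
    change 0 ≤ v w - u w
    by_cases hw' : w ∈ Ioo P.b P.ws
    · have := hv.super u h.contDiffOn w hw' (hmin.isLocalMin (Icc_mem_nhds hw'.1 hw'.2))
      rw [h.F_eq hP hw', EReal.coe_nonneg] at this
      exact nonneg_of_mul_nonneg_right this hP.lam_pos
    · exact (hbd w hw hw').ge
  exact fun x hx => by linarith [hle x hx, hge x hx]

/-! ### Regularity and one-sided derivatives -/

lemma contDiffOn_two_of_hasDerivAt {u u₁ u₂ : ℝ → ℝ} {s : Set ℝ} (hs : IsOpen s)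
    (h₁ : ∀ x ∈ s, HasDerivAt u (u₁ x) x) (h₂ : ∀ x ∈ s, HasDerivAt u₁ (u₂ x) x)
    (hc : ContinuousOn u₂ s) : ContDiffOn ℝ 2 u s := by
  have e₁ : EqOn (deriv u) u₁ s := fun x hx => (h₁ x hx).deriv
  have e₂ : EqOn (deriv u₁) u₂ s := fun x hx => (h₂ x hx).deriv
  have h1 : ContDiffOn ℝ (0 + 1) u₁ s := (contDiffOn_succ_iff_deriv_of_isOpen hs).2
    ⟨fun x hx => (h₂ x hx).differentiableAt.differentiableWithinAt, by simp,
      contDiffOn_zero.2 (hc.congr e₂)⟩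
  have : ContDiffOn ℝ (1 + 1) u s := (contDiffOn_succ_iff_deriv_of_isOpen hs).2
    ⟨fun x hx => (h₁ x hx).differentiableAt.differentiableWithinAt, by simp,
      (by simpa using h1.congr e₁)⟩
  exact this

lemma D1_eq {u : ℝ → ℝ} {p w : ℝ} (hw : w ∈ Ico P.b P.ws) (h : HasDerivAt u p w) :
    D1 P u w = p :=
  h.hasDerivWithinAt.derivWithin (uniqueDiffOn_Ico _ _ w hw)

lemma D2_eq {u u₁ : ℝ → ℝ} {A w : ℝ} (hw : w ∈ Ico P.b P.ws)
    (h₁ : ∀ x ∈ Ico P.b P.ws, HasDerivAt u (u₁ x) x) (h₂ : HasDerivAt u₁ A w) : D2 P u w = A := by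
  have e : EqOn (D1 P u) u₁ (Ico P.b P.ws) := fun x hx => D1_eq hx (h₁ x hx)
  rw [D2, derivWithin_congr e (e hw)]
  exact D1_eq hw h₂

lemma D1_congr {u v : ℝ → ℝ} (h : EqOn v u (Icc P.b P.ws)) :
    EqOn (D1 P v) (D1 P u) (Ico P.b P.ws) := fun _ hw =>
  derivWithin_congr (h.mono Ico_subset_Icc_self) (h (Ico_subset_Icc_self hw))

lemma D2_congr {u v : ℝ → ℝ} (h : EqOn v u (Icc P.b P.ws)) :
    EqOn (D2 P v) (D2 P u) (Ico P.b P.ws) := fun _ hw =>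
  derivWithin_congr (D1_congr h) (D1_congr h hw)

lemma piStar_congr (ε : ℝ) {u v : ℝ → ℝ} (h : EqOn v u (Icc P.b P.ws)) :
    EqOn (piStar P ε v) (piStar P ε u) (Ico P.b P.ws) := fun _ hw => by
  rw [piStar, piStar, D1_congr h hw, D2_congr h hw]

/-! ### The exponent `d` -/

lemma Params.Admissible.R_pos (hP : P.Admissible) : 0 < P.R := by
  have h1 := sub_pos.2 hP.r_lt_mu
  have h2 := hP.sigma_pos
  unfold Params.R
  positivity

lemma Params.Admissible.one_lt_d (hP : P.Admissible) : 1 < P.d := by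
  have hr := hP.r_pos
  have hR := hP.R_pos
  have hs : P.r - P.lam - P.R < Real.sqrt ((P.r + P.lam + P.R) ^ 2 - 4 * P.r * P.lam) := by
    refine Real.lt_sqrt_of_sq_lt ?_
    nlinarith [mul_pos hr hR]
  unfold Params.d
  rw [one_div, inv_mul_eq_div, lt_div_iff₀ (by positivity)]
  linarith

lemma Params.Admissible.d_eq (hP : P.Admissible) :
    (P.d - 1) * (P.r * P.d - P.lam) = P.R * P.d := by
  have hr := hP.r_pos
  have hR := hP.R_pos
  have hl := hP.lam_pos
  -- The discriminant equals `(r - lam)² + 2 R (r + lam) + R²`.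
  have hs := Real.sq_sqrt (show 0 ≤ (P.r + P.lam + P.R) ^ 2 - 4 * P.r * P.lam by
    nlinarith [mul_pos hr hR, mul_pos hl hR, sq_nonneg (P.r - P.lam)])
  unfold Params.d
  generalize Real.sqrt ((P.r + P.lam + P.R) ^ 2 - 4 * P.r * P.lam) = S at hs ⊢
  field_simp
  linear_combination hs

/-! ### Construction of the classical solutions -/

/-- Derivative of `y ↦ K (ε v(y))` along a solution of `y v' = v K(ε v)`, seen from
`w = w_s - y`. -/
lemma hasDerivAt_profile_comp {K u : ℝ → ℝ} {r lam R ε E y w : ℝ} (hε : 0 ≤ ε)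
    (h0 : 1 - K 0 + R * K 0 / (r * K 0 - lam) = 0)
    (hK : ∀ x ∈ Ioo 0 E, HasDerivAt K ((1 - K x + R * K x / (r * K x - lam) - x * K x) / x) x)
    (hu : HasDerivAt u (-(u w * K (ε * u w) / y)) w) (hpos : 0 < u w) (hE : ε * u w < E) :
    HasDerivAt (fun z => K (ε * u z))
      (-((1 - K (ε * u w) + R * K (ε * u w) / (r * K (ε * u w) - lam) -
        ε * u w * K (ε * u w)) * K (ε * u w) / y)) w := by
  -- At `ε = 0` the profile stays at the singular point `0`, where nothing is known about `K'`; the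
  -- composite is constant and `h0` makes the formula vanish. For `ε > 0` the factor `ε u` from the
  -- chain rule cancels the singular denominator.
  rcases hε.eq_or_lt with rfl | hε
  · simp only [zero_mul, h0, sub_zero, zero_div, neg_zero]
    exact hasDerivAt_const _ _
  · refine ((hK _ ⟨mul_pos hε hpos, hE⟩).comp w (hu.const_mul ε)).congr_deriv ?_
    field_simp

/-- Classical solutions for all `ε < E`, expressed by one function `K`. -/
lemma exists_solution_family (hP : P.Admissible) {E : ℝ} (hE : 0 ≤ E) :
    ∃ (K : ℝ → ℝ) (u : ℝ → ℝ → ℝ), Antitone K ∧ (∀ x, 0 < K x) ∧ K 0 = P.d ∧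
      (∀ ε, 0 ≤ ε → ε < E → IsDirichletSolution P ε (u ε) ∧ IsClassicalSolution P ε (u ε) ∧
        ContDiffOn ℝ 2 (u ε) (Ico P.b P.ws) ∧ ∀ w ∈ Ico P.b P.ws,
          0 < ε * D1 P (u ε) w ^ 2 + D2 P (u ε) w ∧
          piStar P ε (u ε) w = (P.mu - P.r) / P.sigma ^ 2 *
            ((P.ws - w) * (P.r - P.lam / K (ε * u ε w)) / P.R)) ∧
      ∀ ε₁ ε₂, 0 ≤ ε₁ → ε₁ ≤ ε₂ → ∀ w ∈ Ico P.b P.ws, ε₁ * u ε₁ w ≤ ε₂ * u ε₂ w := by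
  have hR := hP.R_pos
  have hY : 0 < P.ws - P.b := sub_pos.2 hP.b_lt
  obtain ⟨K, k0, hKc, hKa, hk0, hlk, hKb, hK0, hKd⟩ :=
    exists_profile hP.r_pos hP.lam_pos hR hP.one_lt_d hP.d_eq hE
  have hKpos : ∀ x, 0 < K x := fun x => hk0.trans_le (hKb x).1
  have hden : ∀ x, 0 < P.r * K x - P.lam := fun x => by
    have := mul_le_mul_of_nonneg_left (hKb x).1 hP.r_pos.le
    linarith
  have hG0 : 1 - K 0 + P.R * K 0 / (P.r * K 0 - P.lam) = 0 := by
    have h1 := (hden 0).ne'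
    rw [hK0] at h1 ⊢
    rw [← hP.d_eq, mul_div_assoc, div_self h1]
    ring
  choose v hvY hv using fun ε => exists_value hKc hk0 hKb hY ε
  let u : ℝ → ℝ → ℝ := fun ε w => if w < P.ws then v ε (P.ws - w) else 0
  have hu : ∀ ε, ∀ w < P.ws, u ε w = v ε (P.ws - w) := fun ε w hw => if_pos hw
  have hupos : ∀ ε, ∀ w < P.ws, 0 < u ε w := fun ε w hw => by
    rw [hu ε w hw]; exact (hv ε _ (sub_pos.2 hw)).1
  have hule : ∀ ε, ∀ w ∈ Ico P.b P.ws, u ε w ≤ ((P.ws - w) / (P.ws - P.b)) ^ k0 := by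
    intro ε w hw
    rw [hu ε w hw.2]
    exact (hv ε _ (sub_pos.2 hw.2)).2.2.1 (sub_le_sub_left hw.1 _)
  have hu1 : ∀ ε, ∀ w ∈ Ico P.b P.ws, u ε w ≤ 1 := fun ε w hw =>
    (hule ε w hw).trans (Real.rpow_le_one (div_nonneg (sub_pos.2 hw.2).le hY.le)
      ((div_le_one hY).2 (sub_le_sub_left hw.1 _)) hk0.le)
  have hud : ∀ ε, ∀ w < P.ws,
      HasDerivAt (u ε) (-(u ε w * K (ε * u ε w) / (P.ws - w))) w := by
    intro ε w hw
    have h1 := (hv ε _ (sub_pos.2 hw)).2.1.comp w ((hasDerivAt_id' w).const_sub P.ws)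
    have h2 : u ε =ᶠ[nhds w] v ε ∘ fun z => P.ws - z :=
      Filter.eventually_of_mem (Iio_mem_nhds hw) fun z hz => hu ε z hz
    refine (h1.congr_of_eventuallyEq h2).congr_deriv ?_
    rw [hu ε w hw]; ring
  refine ⟨K, u, hKa, hKpos, hK0, fun ε hε hεE => ?_, fun ε₁ ε₂ h1 h12 w hw => ?_⟩
  · have huc : ContinuousOn (u ε) (Iio P.ws) := fun w hw =>
      (hud ε w hw).continuousAt.continuousWithinAt
    -- An open set containing `b`, so the one-sided derivatives at `b` are ordinary ones; it keeps
    -- `ε u < E`, where the profile equation holds.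
    set U : Set ℝ := Iio P.ws ∩ (fun w => ε * u ε w) ⁻¹' Iio E with hU
    have hUo : IsOpen U := (huc.const_mul ε).isOpen_inter_preimage isOpen_Iio isOpen_Iio
    have hIU : Ico P.b P.ws ⊆ U := fun w hw =>
      ⟨hw.2, (mul_le_of_le_one_right hε (hu1 ε w hw)).trans_lt hεE⟩
    let u₂ : ℝ → ℝ := fun w => u ε w * K (ε * u ε w) / (P.ws - w) ^ 2 *
      (P.R * K (ε * u ε w) / (P.r * K (ε * u ε w) - P.lam) - ε * u ε w * K (ε * u ε w))
    have hu₂ : ∀ w ∈ U, HasDerivAt (fun z => -(u ε z * K (ε * u ε z) / (P.ws - z))) (u₂ w) w := by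
      intro w hw
      have hy : P.ws - w ≠ 0 := (sub_pos.2 hw.1).ne'
      have hk := hasDerivAt_profile_comp hε hG0 hKd (hud ε w hw.1) (hupos ε w hw.1) hw.2
      refine ((((hud ε w hw.1).fun_mul hk).fun_div
        ((hasDerivAt_id' w).const_sub P.ws) hy).fun_neg).congr_deriv ?_
      simp only [u₂]
      generalize P.R * K (ε * u ε w) / (P.r * K (ε * u ε w) - P.lam) = g
      field_simp
      ring
    have hcont₂ : ContinuousOn u₂ U := by
      have h1 : ContinuousOn (u ε) U := huc.mono inter_subset_left
      have h2 : ContinuousOn (fun w => K (ε * u ε w)) U :=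
        hKc.comp_continuousOn (h1.const_mul ε)
      have h3 : ∀ w ∈ U, (P.ws - w) ^ 2 ≠ 0 := fun w hw => pow_ne_zero _ (sub_pos.2 hw.1).ne'
      have h4 : ∀ w ∈ U, P.r * K (ε * u ε w) - P.lam ≠ 0 := fun w _ => (hden _).ne'
      exact ((h1.mul h2).div (by fun_prop) h3).mul
        (((h2.const_mul P.R).div ((h2.const_mul P.r).sub continuousOn_const) h4).sub
          ((h1.const_mul ε).mul h2))
    have hC2 : ContDiffOn ℝ 2 (u ε) U :=
      contDiffOn_two_of_hasDerivAt hUo (fun w hw => hud ε w hw.1) hu₂ hcont₂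
    -- The terms in `ε` cancel, leaving a quantity visibly positive because `r K > lam`.
    have hq : ∀ w < P.ws, ε * (-(u ε w * K (ε * u ε w) / (P.ws - w))) ^ 2 + u₂ w =
        u ε w * K (ε * u ε w) ^ 2 * P.R / ((P.r * K (ε * u ε w) - P.lam) * (P.ws - w) ^ 2) := by
      intro w hw
      have hy : P.ws - w ≠ 0 := (sub_pos.2 hw).ne'
      have hdn := (hden (ε * u ε w)).ne'
      simp only [u₂]
      generalize P.r * K (ε * u ε w) - P.lam = δ at hdn ⊢
      field_simp
      ring
    have hqpos : ∀ w < P.ws,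
        0 < ε * (-(u ε w * K (ε * u ε w) / (P.ws - w))) ^ 2 + u₂ w := by
      intro w hw
      rw [hq w hw]
      have h1 := hupos ε w hw
      have h2 := hKpos (ε * u ε w)
      have h3 := hden (ε * u ε w)
      have h4 := sub_pos.2 hw
      positivity
    have hdd : ∀ w ∈ U, deriv (deriv (u ε)) w = u₂ w := by
      intro w hw
      have : deriv (u ε) =ᶠ[nhds w] fun z => -(u ε z * K (ε * u ε z) / (P.ws - z)) :=
        Filter.eventually_of_mem (Iio_mem_nhds hw.1) fun z hz => (hud ε z hz).deriv
      rw [this.deriv_eq, (hu₂ w hw).deriv]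
    have hcl : IsClassicalSolution P ε (u ε) := by
      refine ⟨hC2.mono (Ioo_subset_Ico_self.trans hIU), fun w hw => ?_, fun w hw => ?_⟩
      · rw [(hud ε w hw.2).deriv, hdd w (hIU (Ioo_subset_Ico_self hw))]
        exact hqpos w hw.2
      · rw [(hud ε w hw.2).deriv, hdd w (hIU (Ioo_subset_Ico_self hw)), hq w hw.2]
        have h1 := (hupos ε w hw.2).ne'
        have h2 := (hKpos (ε * u ε w)).ne'
        have h3 := (hden (ε * u ε w)).ne'
        have h4 := (sub_pos.2 hw.2).ne'
        have h5 := hR.ne'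
        have h6 : P.r * w - P.c = -P.r * (P.ws - w) := by
          unfold Params.ws
          field_simp [hP.r_pos.ne']
          ring
        have h7 : P.R * (-(u ε w * K (ε * u ε w) / (P.ws - w))) ^ 2 /
            (u ε w * K (ε * u ε w) ^ 2 * P.R / ((P.r * K (ε * u ε w) - P.lam) * (P.ws - w) ^ 2)) =
            u ε w * (P.r * K (ε * u ε w) - P.lam) := by
          generalize P.r * K (ε * u ε w) - P.lam = δ at h3 ⊢
          generalize K (ε * u ε w) = k at h2 ⊢
          field_simp
        rw [h7, h6]
        field_simp
        ring
    refine ⟨⟨fun w hw => ?_, fun w hw => ?_, hcl.isViscositySubsolution hP,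
      hcl.isViscositySupersolution hP, ?_, ?_⟩, hcl, hC2.mono hIU, fun w hw => ?_⟩
    · rcases hw.2.eq_or_lt with rfl | hlt
      · have hz : u ε P.ws = 0 := if_neg (lt_irrefl _)
        rw [ContinuousWithinAt, hz]
        -- The power bound with exponent `k0 > 0` gives continuity at the safe level.
        have hlim : Filter.Tendsto (fun w => ((P.ws - w) / (P.ws - P.b)) ^ k0)
            (nhdsWithin P.ws (Icc P.b P.ws)) (nhds 0) := by
          have : Continuous fun w => ((P.ws - w) / (P.ws - P.b)) ^ k0 :=
            (by fun_prop : Continuous fun w => (P.ws - w) / (P.ws - P.b)).rpow_const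
              fun _ => Or.inr hk0.le
          have := this.tendsto P.ws
          simp only [sub_self, zero_div, Real.zero_rpow hk0.ne'] at this
          exact this.mono_left nhdsWithin_le_nhds
        refine tendsto_of_tendsto_of_tendsto_of_le_of_le' tendsto_const_nhds hlim ?_ ?_
        · filter_upwards [self_mem_nhdsWithin] with w hw
          rcases hw.2.eq_or_lt with rfl | hlt
          · exact hz.ge
          · exact (hupos ε w hlt).le
        · filter_upwards [self_mem_nhdsWithin] with w hw
          rcases hw.2.eq_or_lt with rfl | hlt
          · rw [hz, sub_self, zero_div, Real.zero_rpow hk0.ne']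
          · exact hule ε w ⟨hw.1, hlt⟩
      · exact (hud ε w hlt).continuousAt.continuousWithinAt
    · rcases hw.2.eq_or_lt with rfl | hlt
      · exact (if_neg (lt_irrefl _) : u ε P.ws = 0).ge
      · exact (hupos ε w hlt).le
    · rw [hu ε _ hP.b_lt]; exact hvY ε
    · exact if_neg (lt_irrefl _)
    · have e1 := D1_eq hw (hud ε w hw.2)
      have e2 := D2_eq hw (fun x hx => hud ε x hx.2) (hu₂ w (hIU hw))
      rw [piStar, e1, e2]
      refine ⟨hqpos w hw.2, ?_⟩
      rw [hq w hw.2, neg_mul, ← mul_neg]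
      congr 1
      have h1 := (hupos ε w hw.2).ne'
      have h2 := (hKpos (ε * u ε w)).ne'
      have h3 := (hden (ε * u ε w)).ne'
      have h4 := (sub_pos.2 hw.2).ne'
      have h5 := hR.ne'
      have h6 : P.r - P.lam / K (ε * u ε w) = (P.r * K (ε * u ε w) - P.lam) / K (ε * u ε w) := by
        field_simp
      rw [h6]
      generalize P.r * K (ε * u ε w) - P.lam = δ at h3 ⊢
      field_simp
  · have hy := sub_pos.2 hw.2
    rw [hu _ _ hw.2, hu _ _ hw.2]
    exact mul_value_le_mul_value hKc hKpos h1 h12 (hv ε₁ _ hy).1 (hv ε₂ _ hy).1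
      ((hv ε₁ _ hy).2.2.2.trans (hv ε₂ _ hy).2.2.2.symm)

end RobustRuin

/-! ### The optimal feedback -/

theorem proposition6p3 (P : RobustRuin.Params) (hP : P.Admissible) :
    -- for every `ε ≥ 0` the Dirichlet problem has exactly one solution on `[b, w_s]`
    (∀ ε : ℝ, 0 ≤ ε → ∃ u : ℝ → ℝ, RobustRuin.IsDirichletSolution P ε u ∧
      ∀ v : ℝ → ℝ, RobustRuin.IsDirichletSolution P ε v → Set.EqOn v u (Set.Icc P.b P.ws)) ∧
    -- let `u ε` be that solution
    ∀ u : ℝ → ℝ → ℝ, (∀ ε : ℝ, 0 ≤ ε → RobustRuin.IsDirichletSolution P ε (u ε)) →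
      -- the feedback form is well defined and attains the infimum in the equation
      (∀ ε : ℝ, 0 ≤ ε → ContDiffOn ℝ 2 (u ε) (Set.Ico P.b P.ws) ∧
        ∀ w ∈ Set.Ico P.b P.ws,
          0 < ε * (RobustRuin.D1 P (u ε) w) ^ 2 + RobustRuin.D2 P (u ε) w ∧
          IsMinOn (RobustRuin.ham P ε w (RobustRuin.D1 P (u ε) w) (RobustRuin.D2 P (u ε) w))
            Set.univ (RobustRuin.piStar P ε (u ε) w)) ∧
      -- it is non-increasing in `ε ≥ 0`
      (∀ w ∈ Set.Ico P.b P.ws,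
        AntitoneOn (fun ε : ℝ => RobustRuin.piStar P ε (u ε) w) (Set.Ici 0)) ∧
      -- at `ε = 0` it is the non-robust strategy, which therefore bounds it from above
      (∀ w ∈ Set.Ico P.b P.ws, RobustRuin.piStar P 0 (u 0) w = RobustRuin.pi0 P w) ∧
      (∀ ε : ℝ, 0 ≤ ε → ∀ w ∈ Set.Ico P.b P.ws,
        RobustRuin.piStar P ε (u ε) w ≤ RobustRuin.pi0 P w) := by
  refine ⟨fun ε hε => ?_, fun u hu => ?_⟩
  · obtain ⟨K, U, -, -, -, hU, -⟩ :=
      RobustRuin.exists_solution_family hP (by positivity : 0 ≤ ε + 1)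
    obtain ⟨hD, hC, -⟩ := hU ε hε (lt_add_one ε)
    exact ⟨U ε, hD, fun v hv => hC.eqOn hP hD hv⟩
  have hR := hP.R_pos
  have hm : 0 ≤ (P.mu - P.r) / P.sigma ^ 2 := div_nonneg (sub_pos.2 hP.r_lt_mu).le (sq_nonneg _)
  have hanti : ∀ w ∈ Set.Ico P.b P.ws,
      AntitoneOn (fun ε : ℝ => RobustRuin.piStar P ε (u ε) w) (Set.Ici 0) := by
    intro w hw ε₁ h1 ε₂ h2 h12
    -- Taking `E = ε₂ + 1` puts both parameters in one family, so the same `K` represents both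
    -- strategies.
    obtain ⟨K, U, hKa, hKpos, -, hU, hmono⟩ :=
      RobustRuin.exists_solution_family hP (add_nonneg h2 zero_le_one)
    have key : ∀ ε, 0 ≤ ε → ε < ε₂ + 1 → RobustRuin.piStar P ε (u ε) w =
        (P.mu - P.r) / P.sigma ^ 2 * ((P.ws - w) * (P.r - P.lam / K (ε * U ε w)) / P.R) := by
      intro ε hε hlt
      obtain ⟨hD, hC, -, hw'⟩ := hU ε hε hlt
      rw [RobustRuin.piStar_congr ε (hC.eqOn hP hD (hu ε hε)) hw, (hw' w hw).2]
    simp only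
    rw [key ε₁ h1 (by linarith), key ε₂ h2 (lt_add_one _)]
    have hx := hKa (hmono ε₁ ε₂ h1 h12 w hw)
    have hK2 := hKpos (ε₂ * U ε₂ w)
    have hl := hP.lam_pos.le
    have hy := (sub_pos.2 hw.2).le
    gcongr
  have hzero : ∀ w ∈ Set.Ico P.b P.ws,
      RobustRuin.piStar P 0 (u 0) w = RobustRuin.pi0 P w := by
    intro w hw
    obtain ⟨K, U, -, -, hK0, hU, -⟩ := RobustRuin.exists_solution_family hP zero_le_one
    obtain ⟨hD, hC, -, hw'⟩ := hU 0 le_rfl zero_lt_one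
    rw [RobustRuin.piStar_congr 0 (hC.eqOn hP hD (hu 0 le_rfl)) hw, (hw' w hw).2, zero_mul, hK0,
      RobustRuin.pi0]
    have hd1 : P.d - 1 ≠ 0 := (sub_pos.2 hP.one_lt_d).ne'
    have hd0 : P.d ≠ 0 := (zero_lt_one.trans hP.one_lt_d).ne'
    have hr := hP.r_pos.ne'
    -- The quadratic equation for `d`, divided by `d (d - 1)`.
    have h1 : P.r - P.lam / P.d = P.R / (P.d - 1) := by
      field_simp
      linear_combination hP.d_eq
    have h2 : P.ws - w = (P.c - P.r * w) / P.r := by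
      unfold RobustRuin.Params.ws
      field_simp
    rw [h1, h2]
    congr 1
    have h3 := hR.ne'
    field_simp
  refine ⟨fun ε hε => ?_, hanti, hzero, fun ε hε w hw => ?_⟩
  · obtain ⟨K, U, -, -, -, hU, -⟩ :=
      RobustRuin.exists_solution_family hP (by positivity : 0 ≤ ε + 1)
    obtain ⟨hD, hC, hC2, hw'⟩ := hU ε hε (lt_add_one ε)
    have heq := hC.eqOn hP hD (hu ε hε)
    refine ⟨hC2.congr fun x hx => heq (Set.Ico_subset_Icc_self hx), fun w hw => ?_⟩
    have hq := (hw' w hw).1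
    rw [RobustRuin.piStar_congr ε heq hw, RobustRuin.D1_congr heq hw, RobustRuin.D2_congr heq hw]
    refine ⟨hq, fun π _ => ?_⟩
    change RobustRuin.ham P ε w _ _ (RobustRuin.piStar P ε (U ε) w) ≤ RobustRuin.ham P ε w _ _ π
    rw [RobustRuin.piStar, RobustRuin.ham_optimal hP.sigma_pos.ne' hq]
    exact RobustRuin.ham_ge hP.sigma_pos.ne' hq w π
  · rw [← hzero w hw]
    exact hanti w hw (Set.mem_Ici.2 le_rfl) (Set.mem_Ici.2 hε) hε
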